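/- Let $I\subseteq\mathbb R$ be a (finite or infinite) interval of positive length and let $w\ge 0$ be a weight function on $I$: all moments $\int_I x^k w(x)\,dx$, $k\in\mathbb N$, exist, and a non-negative continuous function $u$ on $I$ with $\int_I u(x)w(x)\,dx=0$ vanishes identically. A continuous-stage Runge--Kutta--Nyström (csRKN) method with coefficient functions $\bar A_{\tau,\sigma},\bar B_\tau,B_\tau,C_\tau$ ($\tau,\sigma\in I$) for $q''=f(t,q)$, $q(t_0)=q_0$, $q'(t_0)=q_0'$ is $$Q_\tau=q_0+hC_\tau q_0'+h^2\int_I\bar A_{\tau,\sigma}w(\sigma)f(t_0+C_\sigma h,Q_\sigma)\,d\sigma,$$ $$q_1=q_0+hq_0'+h^2\int_I\bar B_\tau w(\tau)f(t_0+C_\tau h,Q_\tau)\,d\tau,\qquad q_1'=q_0'+h\int_I B_\tau w(\tau)f(t_0+C_\tau h,Q_\tau)\,d\tau .$$ Consider the following conditions, for non-negative integers $\xi,\eta,\zeta$ and all $\tau,\sigma\in I$: $$\mathcal B(\xi):\ \int_I B_\tau w(\tau)C_\tau^{\kappa-1}\,d\tau=\frac1\kappa,\quad 1\le\kappa\le\xi;$$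 $$\mathcal{CN}(\eta):\ \int_I\bar A_{\tau,\sigma}w(\sigma)C_\sigma^{\kappa-1}\,d\sigma=\frac{C_\tau^{\kappa+1}}{\kappa(\kappa+1)},\quad 1\le\kappa\le\eta-1;$$ $$\mathcal{DN}(\zeta):\ \int_I B_\tau w(\tau)C_\tau^{\kappa-1}\bar A_{\tau,\sigma}\,d\tau=\frac{B_\sigma C_\sigma^{\kappa+1}}{\kappa(\kappa+1)}-\frac{B_\sigma C_\sigma}{\kappa}+\frac{B_\sigma}{\kappa+1},\quad 1\le\kappa\le\zeta-1.$$ **Theorem.** Suppose that $C_\tau=\tau$ and $\bar B_\tau=B_\tau(1-\tau)$ on $I$, that $\mathcal B(\xi)$, $\mathcal{CN}(\eta)$ and $\mathcal{DN}(\zeta)$ hold, that $\bar A_{\tau,\sigma}$ is a polynomial of degree at most $\pi_A^\tau$ in $\tau$ and at most $\pi_A^\sigma$ in $\sigma$, and that $B_\tau$ is a polynomial of degree at most $\pi_B^\tau$. Let $c_1,\dots,c_s\in I$ be distinct, let $b_i=\int_I\ell_i(\tau)w(\tau)\,d\tau$ with $\ell_i(\tau)=\prod_{j\ne i}\frac{\tau-c_j}{c_i-c_j}$,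 and suppose that the quadrature formula $\int_I\Phi(\tau)w(\tau)\,d\tau\approx\sum_{i=1}^s b_i\Phi(c_i)$ has order $p$, i.e. is exact for all polynomials $\Phi$ of degree at most $p-1$. Then the $s$-stage RKN method $$Q_i=q_0+hc_iq_0'+h^2\sum_{j=1}^s b_j\bar A_{c_i,c_j}f(t_0+c_jh,Q_j),\quad i=1,\dots,s,$$ $$q_1=q_0+hq_0'+h^2\sum_{i=1}^s b_i\bar B_{c_i}f(t_0+c_ih,Q_i),\qquad q_1'=q_0'+h\sum_{i=1}^s b_iB_{c_i}f(t_0+c_ih,Q_i)$$ has order at least $$\min\{\rho,\,2\alpha+2,\,\alpha+\beta\},$$ where $\rho=\min\{\xi,p-\pi_B^\tau\}$, $\alpha=\min\{\eta,p-\pi_A^\sigma+1\}$ and $\beta=\min\{\zeta,p-\pi_A^\tau-\pi_B^\tau+1\}$ (integers, possibly negative; a negative lower bound claims nothing). Here a method has order at least $r\in\mathbb N$ if, for every dimension $d$, every $C^\infty$ function $f:\mathbb R\times\mathbb R^d\to\mathbb R^d$ and all initial data, the stage equations have, for all sufficiently small $|h|$, exactly one solution $(Q_i)$ in some fixed neighbourhood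 of $q_0$, and the resulting local errors satisfy $q(t_0+h)-q_1=\mathcal O(h^{r+1})$ and $q'(t_0+h)-q_1'=\mathcal O(h^{r+1})$ as $h\to0$, $q$ being the exact solution. -/

import Mathlib

open MeasureTheory
open scoped ContDiff Topology

noncomputable section

/-- A non-negative function `w` is a weight function on `I` if all its moments over `I` exist and
if a non-negative continuous `u` on `I` with `∫_I u w = 0` vanishes on `I`. The condition that
`u w` be integrable keeps divergent integrals (whose Bochner value is `0`) out of the second
requirement. -/
structure IsWeight (I : Set ℝ) (w : ℝ → ℝ) : Prop where
  nonneg : ∀ x ∈ I, 0 ≤ w x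
  moments : ∀ k : ℕ, IntegrableOn (fun x => x ^ k * w x) I
  definite : ∀ u : ℝ → ℝ, ContinuousOn u I → (∀ x ∈ I, 0 ≤ u x) →
    IntegrableOn (fun x => u x * w x) I → ∫ x in I, u x * w x = 0 → ∀ x ∈ I, u x = 0

/-- A continuous-stage Runge-Kutta-Nystrom method: a finite or infinite interval `I` of positive
length, a weight function `w` on it, and the coefficient functions of the scheme
`Q_τ = q₀ + h C_τ q₀' + h² ∫_I A_{τ,σ} w(σ) f(t₀ + C_σ h, Q_σ) dσ`,
`q₁ = q₀ + h q₀' + h² ∫_I Bbar_τ w(τ) f(t₀ + C_τ h, Q_τ) dτ`,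
`q₁' = q₀' + h ∫_I B_τ w(τ) f(t₀ + C_τ h, Q_τ) dτ`.
Only the values of the functions on `I` matter. -/
structure CSRKN where
  I : Set ℝ
  interval : I.OrdConnected
  nondegenerate : (interior I).Nonempty
  w : ℝ → ℝ
  weight : IsWeight I w
  A : ℝ → ℝ → ℝ
  Bbar : ℝ → ℝ
  B : ℝ → ℝ
  C : ℝ → ℝ

namespace CSRKN

/-- The simplifying assumption `B(ξ)`: the conditions for `1 ≤ κ ≤ ξ`. -/
def SimplB (M : CSRKN) (ξ : ℕ) : Prop :=
  ∀ κ : ℕ, 1 ≤ κ → κ ≤ ξ →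
    IntegrableOn (fun τ => M.B τ * M.w τ * M.C τ ^ (κ - 1)) M.I ∧
    ∫ τ in M.I, M.B τ * M.w τ * M.C τ ^ (κ - 1) = 1 / (κ : ℝ)

/-- The simplifying assumption `CN(η)`: the conditions for `1 ≤ κ ≤ η - 1`. -/
def SimplCN (M : CSRKN) (η : ℕ) : Prop :=
  ∀ κ : ℕ, 1 ≤ κ → κ + 1 ≤ η → ∀ τ ∈ M.I,
    IntegrableOn (fun σ => M.A τ σ * M.w σ * M.C σ ^ (κ - 1)) M.I ∧
    ∫ σ in M.I, M.A τ σ * M.w σ * M.C σ ^ (κ - 1) =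
      M.C τ ^ (κ + 1) / ((κ : ℝ) * ((κ : ℝ) + 1))

/-- The simplifying assumption `DN(ζ)`: the conditions for `1 ≤ κ ≤ ζ - 1`. -/
def SimplDN (M : CSRKN) (ζ : ℕ) : Prop :=
  ∀ κ : ℕ, 1 ≤ κ → κ + 1 ≤ ζ → ∀ σ ∈ M.I,
    IntegrableOn (fun τ => M.B τ * M.w τ * M.C τ ^ (κ - 1) * M.A τ σ) M.I ∧
    ∫ τ in M.I, M.B τ * M.w τ * M.C τ ^ (κ - 1) * M.A τ σ =
      M.B σ * M.C σ ^ (κ + 1) / ((κ : ℝ) * ((κ : ℝ) + 1)) - M.B σ * M.C σ / (κ : ℝ)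
        + M.B σ / ((κ : ℝ) + 1)

end CSRKN

/-- The weights of the interpolatory quadrature formula with nodes `c` for the weight `w` on `I`:
integrals of the Lagrange basis polynomials against `w`. -/
def quadWeight {s : ℕ} (I : Set ℝ) (w : ℝ → ℝ) (c : Fin s → ℝ) (i : Fin s) : ℝ :=
  ∫ τ in I, (Lagrange.basis Finset.univ c i).eval τ * w τ

/-- The interpolatory quadrature formula with nodes `c` has order (at least) `p`: it is exact for
all polynomials of degree at most `p - 1`. -/
def QuadOrder {s : ℕ} (I : Set ℝ) (w : ℝ → ℝ) (c : Fin s → ℝ) (p : ℕ) : Prop :=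
  ∀ Φ : Polynomial ℝ, Φ.degree < (p : WithBot ℕ) →
    ∫ τ in I, Φ.eval τ * w τ = ∑ i, quadWeight I w c i * Φ.eval (c i)

/-- The Butcher tableau of an `s`-stage Runge-Kutta-Nystrom method. -/
structure RKN (s : ℕ) where
  c : Fin s → ℝ
  a : Fin s → Fin s → ℝ
  bbar : Fin s → ℝ
  b : Fin s → ℝ

/-- The `s`-stage Runge-Kutta-Nystrom method obtained by replacing the integrals of a
continuous-stage method by the interpolatory quadrature formula with nodes `c`. -/
def CSRKN.discretize {s : ℕ} (M : CSRKN) (c : Fin s → ℝ) : RKN s where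
  c i := M.C (c i)
  a i j := quadWeight M.I M.w c j * M.A (c i) (c j)
  bbar i := quadWeight M.I M.w c i * M.Bbar (c i)
  b i := quadWeight M.I M.w c i * M.B (c i)

namespace RKN

variable {s d : ℕ}

/-- `Q` solves the stage equations of one step of size `h` from `(t₀, q₀, v₀)` for
`q'' = f(t, q)`. -/
def IsStage (R : RKN s) (f : ℝ × EuclideanSpace ℝ (Fin d) → EuclideanSpace ℝ (Fin d))
    (t₀ : ℝ) (q₀ v₀ : EuclideanSpace ℝ (Fin d)) (h : ℝ)
    (Q : Fin s → EuclideanSpace ℝ (Fin d)) : Prop :=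
  ∀ i, Q i = q₀ + (h * R.c i) • v₀ + h ^ 2 • ∑ j, R.a i j • f (t₀ + R.c j * h, Q j)

/-- The numerical position `q₁` after one step with stages `Q`. -/
def stepPos (R : RKN s) (f : ℝ × EuclideanSpace ℝ (Fin d) → EuclideanSpace ℝ (Fin d))
    (t₀ : ℝ) (q₀ v₀ : EuclideanSpace ℝ (Fin d)) (h : ℝ)
    (Q : Fin s → EuclideanSpace ℝ (Fin d)) : EuclideanSpace ℝ (Fin d) :=
  q₀ + h • v₀ + h ^ 2 • ∑ i, R.bbar i • f (t₀ + R.c i * h, Q i)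

/-- The numerical velocity `q₁'` after one step with stages `Q`. -/
def stepVel (R : RKN s) (f : ℝ × EuclideanSpace ℝ (Fin d) → EuclideanSpace ℝ (Fin d))
    (t₀ : ℝ) (v₀ : EuclideanSpace ℝ (Fin d)) (h : ℝ)
    (Q : Fin s → EuclideanSpace ℝ (Fin d)) : EuclideanSpace ℝ (Fin d) :=
  v₀ + h • ∑ i, R.b i • f (t₀ + R.c i * h, Q i)

end RKN

/-- Near `t₀` the function `q`, with derivative `v`, solves the initial value problem
`q'' = f(t, q)`, `q(t₀) = q₀`, `q'(t₀) = v₀`. -/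
structure IsLocalSolution {d : ℕ}
    (f : ℝ × EuclideanSpace ℝ (Fin d) → EuclideanSpace ℝ (Fin d)) (t₀ : ℝ)
    (q₀ v₀ : EuclideanSpace ℝ (Fin d)) (q v : ℝ → EuclideanSpace ℝ (Fin d)) : Prop where
  init_pos : q t₀ = q₀
  init_vel : v t₀ = v₀
  hasDeriv_pos : ∀ᶠ t in 𝓝 t₀, HasDerivAt q (v t) t
  hasDeriv_vel : ∀ᶠ t in 𝓝 t₀, HasDerivAt v (f (t, q t)) t

/-- The method has order at least `r`: for every smooth problem, in every dimension, and for all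
small step sizes `h` the (in general implicit) stage equations have exactly one solution near the
initial value, and the local errors `q(t₀+h) - q₁` and `q'(t₀+h) - q₁'` of the step computed
from it are `O(h^(r+1))` as `h → 0`. -/
def RKN.HasOrderAtLeast {s : ℕ} (R : RKN s) (r : ℕ) : Prop :=
  ∀ (d : ℕ) (f : ℝ × EuclideanSpace ℝ (Fin d) → EuclideanSpace ℝ (Fin d)), ContDiff ℝ ∞ f →
  ∀ (t₀ : ℝ) (q₀ v₀ : EuclideanSpace ℝ (Fin d)) (q v : ℝ → EuclideanSpace ℝ (Fin d)),
  IsLocalSolution f t₀ q₀ v₀ q v →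
  ∃ ε > 0, ∃ h₀ > 0, ∃ K : ℝ, ∀ h : ℝ, |h| ≤ h₀ →
    (∃! Q : Fin s → EuclideanSpace ℝ (Fin d),
      R.IsStage f t₀ q₀ v₀ h Q ∧ ∀ i, ‖Q i - q₀‖ ≤ ε) ∧
    ∀ Q : Fin s → EuclideanSpace ℝ (Fin d),
      R.IsStage f t₀ q₀ v₀ h Q → (∀ i, ‖Q i - q₀‖ ≤ ε) →
      ‖q (t₀ + h) - R.stepPos f t₀ q₀ v₀ h Q‖ ≤ K * |h| ^ (r + 1) ∧
      ‖v (t₀ + h) - R.stepVel f t₀ v₀ h Q‖ ≤ K * |h| ^ (r + 1)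

end

open Asymptotics Filter Finset

theorem isBigO_pow_pow_of_le {m n : ℕ} (hmn : n ≤ m) :
    (fun x : ℝ => x ^ m) =O[𝓝 0] fun x : ℝ => x ^ n := by
  obtain ⟨k, rfl⟩ := Nat.exists_eq_add_of_le hmn
  have h : (fun x : ℝ => x ^ k) =O[𝓝 0] fun _ : ℝ => (1 : ℝ) :=
    (continuous_pow k).continuousAt.isBigO_one ℝ
  simpa [pow_add] using (isBigO_refl (fun x : ℝ => x ^ n) (𝓝 0)).mul h

theorem Asymptotics.IsBigO.pow_weaken {V : Type*} [NormedAddCommGroup V] {u : ℝ → V} {m n : ℕ}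
    (hu : u =O[𝓝 0] fun x : ℝ => x ^ m) (hmn : n ≤ m) : u =O[𝓝 0] fun x : ℝ => x ^ n :=
  hu.trans (isBigO_pow_pow_of_le hmn)

theorem Asymptotics.IsBigO.comp_mul_left_pow {V : Type*} [NormedAddCommGroup V] {u : ℝ → V} {n : ℕ}
    (hu : u =O[𝓝 0] fun x : ℝ => x ^ n) (c : ℝ) :
    (fun x : ℝ => u (c * x)) =O[𝓝 0] fun x : ℝ => x ^ n := by
  have ht : Tendsto (fun x : ℝ => c * x) (𝓝 0) (𝓝 0) := by
    simpa using (continuous_const_mul c).tendsto (0 : ℝ)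
  refine (hu.comp_tendsto ht).trans ?_
  simpa [Function.comp_def, mul_pow] using
    (isBigO_refl (fun x : ℝ => x ^ n) (𝓝 0)).const_mul_left (c ^ n)

section Expansion

variable {V : Type*} [NormedAddCommGroup V] [NormedSpace ℝ V]

theorem Asymptotics.IsBigO.pow_smul {u : ℝ → V} {n : ℕ}
    (hu : u =O[𝓝 0] fun x : ℝ => x ^ n) (m : ℕ) :
    (fun x : ℝ => x ^ m • u x) =O[𝓝 0] fun x : ℝ => x ^ (m + n) := by
  simpa [pow_add] using (isBigO_refl (fun x : ℝ => x ^ m) (𝓝 0)).smul hu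

/-- If `u' = O(xⁿ)` and `u 0 = 0` then `u = O(xⁿ⁺¹)`. -/
theorem isBigO_pow_succ_of_hasDerivAt {u u' : ℝ → V} {n : ℕ}
    (hu : ∀ᶠ x in 𝓝 0, HasDerivAt u (u' x) x) (h0 : u 0 = 0)
    (hu' : u' =O[𝓝 0] fun x : ℝ => x ^ n) : u =O[𝓝 0] fun x : ℝ => x ^ (n + 1) := by
  obtain ⟨C, hC⟩ := hu'.bound
  obtain ⟨δ, hδ, hball⟩ := Metric.eventually_nhds_iff_ball.1 (hu.and hC)
  refine IsBigO.of_bound C ?_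
  filter_upwards [Metric.ball_mem_nhds (0 : ℝ) hδ] with x hx
  have hsub : ∀ y ∈ Metric.closedBall (0 : ℝ) |x|, y ∈ Metric.ball (0 : ℝ) δ := by
    intro y hy
    simp only [Metric.mem_ball, dist_zero_right, Metric.mem_closedBall, Real.norm_eq_abs] at *
    linarith
  have hC0 : ∀ y ∈ Metric.closedBall (0 : ℝ) |x|, ‖u' y‖ ≤ ‖C‖ * |x| ^ n := by
    intro y hy
    refine (hball y (hsub y hy)).2.trans ?_
    have hy' : |y| ≤ |x| := by simpa using hy
    rw [norm_pow, Real.norm_eq_abs]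
    gcongr
    exact Real.le_norm_self C
  by_cases hx0 : x = 0
  · simp [hx0, h0]
  have hCn : 0 ≤ C := by
    have := (norm_nonneg _).trans (hball x hx).2
    exact nonneg_of_mul_nonneg_left this (norm_pos_iff.2 (pow_ne_zero n hx0))
  have := (convex_closedBall (0 : ℝ) |x|).norm_image_sub_le_of_norm_hasDerivWithin_le
    (fun y hy => (hball y (hsub y hy)).1.hasDerivWithinAt) hC0
    (Metric.mem_closedBall_self (abs_nonneg x)) (show x ∈ Metric.closedBall (0 : ℝ) |x| by simp)
  rw [h0, sub_zero, sub_zero, Real.norm_of_nonneg hCn] at this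
  rw [norm_pow, pow_succ, Real.norm_eq_abs, ← mul_assoc]
  exact this

theorem hasDerivAt_sum_pow_smul (a : ℕ → V) (N l : ℕ) (x : ℝ) :
    HasDerivAt (fun x : ℝ => ∑ m ∈ range N, x ^ (m + l + 1) • a m)
      (∑ m ∈ range N, x ^ (m + l) • ((m + l + 1 : ℝ) • a m)) x := by
  refine HasDerivAt.fun_sum fun m _ => ?_
  have := (hasDerivAt_pow (m + l + 1) x).smul_const (a m)
  convert this using 1
  rw [smul_smul, Nat.add_sub_cancel, mul_comm]
  push_cast
  rfl

/-- Integration of an asymptotic expansion. -/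
theorem isBigO_expansion_of_hasDerivAt {u u' : ℝ → V} {a : ℕ → V} {N l : ℕ}
    (hu : ∀ᶠ x in 𝓝 0, HasDerivAt u (u' x) x) (h0 : u 0 = 0)
    (hu' : (fun x : ℝ => u' x - ∑ m ∈ range N, x ^ (m + l) • a m)
      =O[𝓝 0] fun x : ℝ => x ^ (N + l)) :
    (fun x : ℝ => u x - ∑ m ∈ range N, x ^ (m + l + 1) • ((m + l + 1 : ℝ)⁻¹ • a m))
      =O[𝓝 0] fun x : ℝ => x ^ (N + l + 1) := by
  refine isBigO_pow_succ_of_hasDerivAt ?_ (by simp [h0]) hu'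
  filter_upwards [hu] with x hx
  have h := hasDerivAt_sum_pow_smul (fun m => (m + l + 1 : ℝ)⁻¹ • a m) N l x
  have hs : ∑ m ∈ range N, x ^ (m + l) • ((m + l + 1 : ℝ) • ((m + l + 1 : ℝ)⁻¹ • a m))
      = ∑ m ∈ range N, x ^ (m + l) • a m := by
    refine sum_congr rfl fun m _ => ?_
    rw [smul_smul (m + l + 1 : ℝ), mul_inv_cancel₀ (by positivity), one_smul]
  rw [hs] at h
  exact hx.sub h

theorem exists_taylor_expansion (N : ℕ) : ∀ {g : ℝ → V}, ContDiffAt ℝ N g 0 →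
    ∃ a : ℕ → V, (fun x : ℝ => g x - ∑ m ∈ range N, x ^ m • a m)
      =O[𝓝 0] fun x : ℝ => x ^ N := by
  induction N with
  | zero =>
    intro g hg
    refine ⟨fun _ => 0, ?_⟩
    simpa using hg.continuousAt.isBigO_one ℝ
  | succ N ih =>
    intro g hg
    have hg' : ContDiffAt ℝ N (deriv g) 0 := by
      simpa only [fderiv_apply_one_eq_deriv] using
        (hg.fderiv_right (m := N) (by simp)).clm_apply (contDiffAt_const (c := (1 : ℝ)))
    obtain ⟨a, ha⟩ := ih hg'
    have hd : ∀ᶠ x in 𝓝 (0 : ℝ), HasDerivAt (fun x => g x - g 0) (deriv g x) x := by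
      have h1 : ContDiffAt ℝ 1 g 0 := hg.of_le (by exact_mod_cast Nat.succ_le_succ (Nat.zero_le N))
      filter_upwards [h1.eventually (by simp)] with x hx
      exact (hx.differentiableAt (by simp)).hasDerivAt.sub_const _
    have := isBigO_expansion_of_hasDerivAt (l := 0) hd (by simp) (by simpa using ha)
    refine ⟨fun m => Nat.casesOn m (g 0) fun k => (k + 1 : ℝ)⁻¹ • a k, ?_⟩
    simpa [sum_range_succ', sub_sub, add_comm] using this

/-- Weighted sums of an expansion along the nodes `c`. -/
theorem isBigO_sum_smul_comp_mul {ι : Type*} [Fintype ι] {g : ℝ → V} {a : ℕ → V} {N : ℕ}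
    (hg : (fun x : ℝ => g x - ∑ m ∈ range N, x ^ m • a m) =O[𝓝 0] fun x : ℝ => x ^ N)
    (w c : ι → ℝ) :
    (fun x : ℝ => ∑ j, w j • g (c j * x) - ∑ m ∈ range N, x ^ m • ((∑ j, w j * c j ^ m) • a m))
      =O[𝓝 0] fun x : ℝ => x ^ N := by
  have h : (fun x : ℝ => ∑ j, w j • (g (c j * x) - ∑ m ∈ range N, (c j * x) ^ m • a m))
      =O[𝓝 0] fun x : ℝ => x ^ N :=
    IsBigO.fun_sum fun j _ => (hg.comp_mul_left_pow (c j)).const_smul_left (w j)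
  refine h.congr_left fun x => ?_
  simp only [smul_sub, sum_sub_distrib, smul_sum, sum_smul, smul_smul]
  congr 1
  rw [sum_comm]
  refine sum_congr rfl fun m _ => sum_congr rfl fun j _ => ?_
  congr 1
  ring

/-- An expansion whose coefficients vanish below degree `n`. -/
theorem isBigO_pow_of_expansion {u : ℝ → V} {a : ℕ → V} {γ : ℕ → ℝ} {N l n : ℕ}
    (hu : (fun x : ℝ => u x - ∑ m ∈ range N, x ^ (m + l) • (γ m • a m))
      =O[𝓝 0] fun x : ℝ => x ^ (N + l))
    (hN : n ≤ N + l) (hγ : ∀ m, m + l < n → γ m = 0) : u =O[𝓝 0] fun x : ℝ => x ^ n := by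
  have h : (fun x : ℝ => ∑ m ∈ range N, x ^ (m + l) • (γ m • a m))
      =O[𝓝 0] fun x : ℝ => x ^ n := by
    refine IsBigO.fun_sum fun m _ => ?_
    by_cases hm : m + l < n
    · simpa [hγ m hm] using isBigO_zero (fun x : ℝ => x ^ n) (𝓝 0)
    · have h1 : (fun _ : ℝ => γ m • a m) =O[𝓝 0] fun x : ℝ => x ^ 0 := by
        simpa using isBigO_const_const (γ m • a m) (one_ne_zero (α := ℝ)) (𝓝 (0 : ℝ))
      exact (h1.pow_smul (m + l)).pow_weaken (by omega)
  simpa using (hu.pow_weaken hN).add h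

end Expansion

section Smoothness

variable {V : Type*} [NormedAddCommGroup V] [NormedSpace ℝ V]

theorem contDiffAt_succ_of_hasDerivAt {u u' : ℝ → V} {t₀ : ℝ} {n : ℕ}
    (hu : ∀ᶠ t in 𝓝 t₀, HasDerivAt u (u' t) t) (hu' : ContDiffAt ℝ n u' t₀) :
    ContDiffAt ℝ (n + 1 : ℕ) u t₀ := by
  refine contDiffAt_succ_iff_hasFDerivAt.2
    ⟨fun t => ContinuousLinearMap.toSpanSingleton ℝ (u' t), ⟨_, hu, fun t ht => ?_⟩, ?_⟩
  · exact (ht : HasDerivAt u (u' t) t).hasFDerivAt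
  · exact (ContinuousLinearMap.toSpanSingletonCLE (𝕜 := ℝ) (E := V)).contDiff.contDiffAt.comp t₀ hu'

theorem contDiffAt_zero_of_hasDerivAt {u u' : ℝ → V} {t₀ : ℝ}
    (hu : ∀ᶠ t in 𝓝 t₀, HasDerivAt u (u' t) t) : ContDiffAt ℝ (0 : ℕ) u t₀ :=
  contDiffAt_zero.2 ⟨_, hu, fun t ht =>
    (ht : HasDerivAt u (u' t) t).continuousAt.continuousWithinAt⟩

theorem IsLocalSolution.contDiffAt {d : ℕ}
    {f : ℝ × EuclideanSpace ℝ (Fin d) → EuclideanSpace ℝ (Fin d)} (hf : ContDiff ℝ ∞ f) {t₀ : ℝ}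
    {q₀ v₀ : EuclideanSpace ℝ (Fin d)} {q v : ℝ → EuclideanSpace ℝ (Fin d)}
    (hq : IsLocalSolution f t₀ q₀ v₀ q v) (n : ℕ) :
    ContDiffAt ℝ n q t₀ ∧ ContDiffAt ℝ n v t₀ := by
  induction n with
  | zero => exact ⟨contDiffAt_zero_of_hasDerivAt hq.hasDeriv_pos,
      contDiffAt_zero_of_hasDerivAt hq.hasDeriv_vel⟩
  | succ n ih =>
    refine ⟨contDiffAt_succ_of_hasDerivAt hq.hasDeriv_pos ih.2,
      contDiffAt_succ_of_hasDerivAt hq.hasDeriv_vel ?_⟩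
    have hfn : ContDiff ℝ n f := hf.of_le (by exact_mod_cast le_top)
    exact hfn.contDiffAt.comp t₀ (contDiffAt_id.prodMk ih.1)

/-- Local estimates for a smooth right-hand side: boundedness, the Lipschitz estimate, and the
quadratic remainder of the linearization in the second variable. -/
theorem exists_local_estimates {f : ℝ × V → V} (hf : ContDiff ℝ ∞ f) (t₀ : ℝ) (q₀ : V) :
    ∃ ε > 0, ∃ L ≥ (0 : ℝ), ∀ t x, |t - t₀| ≤ ε → ‖x - q₀‖ ≤ ε → ‖f (t, x)‖ ≤ L ∧
      ∀ y, ‖y - q₀‖ ≤ ε → ‖f (t, x) - f (t, y)‖ ≤ L * ‖x - y‖ ∧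
        ‖f (t, x) - f (t, y) - fderiv ℝ f (t, y) (0, x - y)‖ ≤ L * ‖x - y‖ ^ 2 := by
  have h1 : ContDiff ℝ 1 f := hf.of_le (by exact_mod_cast le_top)
  have h2 : ContDiff ℝ 1 (fderiv ℝ f) :=
    (contDiff_infty.1 hf 2).fderiv_right
      (by rw [one_add_one_eq_two]; rfl)
  obtain ⟨K₁, s₁, hs₁, hK₁⟩ := (h1.contDiffAt (x := (t₀, q₀))).exists_lipschitzOnWith
  obtain ⟨K₂, s₂, hs₂, hK₂⟩ := (h2.contDiffAt (x := (t₀, q₀))).exists_lipschitzOnWith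
  obtain ⟨ε, hε, hball⟩ := Metric.nhds_basis_closedBall.mem_iff.1 (inter_mem hs₁ hs₂)
  have hmem : ∀ t x, |t - t₀| ≤ ε → ‖x - q₀‖ ≤ ε → (t, x) ∈ s₁ ∩ s₂ := fun t x ht hx =>
    hball (by simpa [Prod.dist_eq, dist_eq_norm, Real.norm_eq_abs] using ⟨ht, hx⟩)
  have hdist : ∀ (t : ℝ) (x y : V), dist (t, x) (t, y) = ‖x - y‖ := fun t x y => by
    simp [dist_eq_norm]
  refine ⟨ε, hε, max (‖f (t₀, q₀)‖ + K₁ * ε) (max K₁ K₂), by positivity, fun t x ht hx => ⟨?_, ?_⟩⟩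
  · refine le_trans ?_ (le_max_left _ _)
    have h := hK₁.dist_le_mul _ (hmem t x ht hx).1 _ (hmem t₀ q₀ (by simpa using hε.le)
      (by simpa using hε.le)).1
    have hd : dist (t, x) (t₀, q₀) ≤ ε := by
      simpa [Prod.dist_eq, dist_eq_norm, Real.norm_eq_abs] using ⟨ht, hx⟩
    rw [dist_eq_norm] at h
    calc ‖f (t, x)‖ ≤ ‖f (t₀, q₀)‖ + ‖f (t, x) - f (t₀, q₀)‖ := norm_le_norm_add_norm_sub' _ _
      _ ≤ _ := by gcongr; exact h.trans (by gcongr)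
  · intro y hy
    constructor
    · have h := hK₁.dist_le_mul _ (hmem t x ht hx).1 _ (hmem t y ht hy).1
      rw [dist_eq_norm, hdist] at h
      exact h.trans (by gcongr; exact (le_max_left _ _).trans (le_max_right _ _))
    · have hseg : ∀ z ∈ segment ℝ y x, ‖z - q₀‖ ≤ ε ∧ ‖z - y‖ ≤ ‖x - y‖ := by
        intro z hz
        refine ⟨?_, ?_⟩
        · have := (convex_closedBall q₀ ε).segment_subset (x := y) (y := x)
            (by simpa [dist_eq_norm] using hy) (by simpa [dist_eq_norm] using hx) hz
          simpa [dist_eq_norm] using this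
        · have := (convex_closedBall y ‖x - y‖).segment_subset (x := y) (y := x)
            (by simp) (by simp [dist_eq_norm]) hz
          simpa [dist_eq_norm] using this
      have hder : ∀ z ∈ segment ℝ y x, HasFDerivWithinAt (fun z => f (t, z))
          ((fderiv ℝ f (t, z)).comp (ContinuousLinearMap.inr ℝ ℝ V)) (segment ℝ y x) z := by
        intro z _
        exact ((h1.differentiable (by simp) (t, z)).hasFDerivAt.comp z
          (hasFDerivAt_prodMk_right t z)).hasFDerivWithinAt
      have hbound : ∀ z ∈ segment ℝ y x,
          ‖(fderiv ℝ f (t, z)).comp (ContinuousLinearMap.inr ℝ ℝ V) -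
            (fderiv ℝ f (t, y)).comp (ContinuousLinearMap.inr ℝ ℝ V)‖ ≤ K₂ * ‖x - y‖ := by
        intro z hz
        have h := hK₂.dist_le_mul _ (hmem t z ht (hseg z hz).1).2 _ (hmem t y ht hy).2
        rw [dist_eq_norm, hdist] at h
        rw [← ContinuousLinearMap.sub_comp]
        calc _ ≤ ‖fderiv ℝ f (t, z) - fderiv ℝ f (t, y)‖ * ‖ContinuousLinearMap.inr ℝ ℝ V‖ :=
              ContinuousLinearMap.opNorm_comp_le _ _
          _ ≤ ‖fderiv ℝ f (t, z) - fderiv ℝ f (t, y)‖ * 1 := by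
              gcongr
              exact ContinuousLinearMap.norm_inr_le_one ℝ ℝ V
          _ ≤ K₂ * ‖x - y‖ := by
              rw [mul_one]
              exact h.trans (by gcongr; exact (hseg z hz).2)
      have h := (convex_segment y x).norm_image_sub_le_of_norm_hasFDerivWithin_le' hder hbound
        (left_mem_segment ℝ y x) (right_mem_segment ℝ y x)
      refine le_trans ?_ (h.trans ?_)
      · simp
      · rw [mul_assoc, ← sq]
        gcongr
        exact (le_max_right _ _).trans (le_max_right _ _)

end Smoothness

/-- The stage equations are uniquely solvable for small step sizes. -/
theorem RKN.eventually_existsUnique_isStage {s d : ℕ} (R : RKN s)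
    {f : ℝ × EuclideanSpace ℝ (Fin d) → EuclideanSpace ℝ (Fin d)} {t₀ : ℝ}
    {q₀ : EuclideanSpace ℝ (Fin d)} (v₀ : EuclideanSpace ℝ (Fin d)) {ε L : ℝ} (hε : 0 < ε)
    (hbd : ∀ t x, |t - t₀| ≤ ε → ‖x - q₀‖ ≤ ε → ‖f (t, x)‖ ≤ L)
    (hlip : ∀ t x y, |t - t₀| ≤ ε → ‖x - q₀‖ ≤ ε → ‖y - q₀‖ ≤ ε →
      ‖f (t, x) - f (t, y)‖ ≤ L * ‖x - y‖) :
    ∀ᶠ h in 𝓝 (0 : ℝ), ∃! Q : Fin s → EuclideanSpace ℝ (Fin d),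
      R.IsStage f t₀ q₀ v₀ h Q ∧ ∀ i, ‖Q i - q₀‖ ≤ ε := by
  have e1 : ∀ᶠ h in 𝓝 (0 : ℝ), ∀ j, |R.c j * h| ≤ ε := eventually_all.2 fun j => by
    have : Tendsto (fun h : ℝ => |R.c j * h|) (𝓝 0) (𝓝 |R.c j * 0|) :=
      Continuous.tendsto (by fun_prop) 0
    rw [mul_zero, abs_zero] at this
    exact this.eventually_le_const hε
  have e2 : ∀ᶠ h in 𝓝 (0 : ℝ), ∀ i, |h * R.c i| * ‖v₀‖ + h ^ 2 * ∑ j, |R.a i j| * L ≤ ε :=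
    eventually_all.2 fun i => by
      have : Tendsto (fun h : ℝ => |h * R.c i| * ‖v₀‖ + h ^ 2 * ∑ j, |R.a i j| * L) (𝓝 0)
          (𝓝 (|0 * R.c i| * ‖v₀‖ + 0 ^ 2 * ∑ j, |R.a i j| * L)) :=
        Continuous.tendsto (by fun_prop) 0
      simp only [zero_mul, abs_zero, ne_eq, OfNat.ofNat_ne_zero, not_false_eq_true, zero_pow,
        add_zero] at this
      exact this.eventually_le_const hε
  have e3 : ∀ᶠ h in 𝓝 (0 : ℝ), ∀ i, h ^ 2 * ∑ j, |R.a i j| * L ≤ 1 / 2 :=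
    eventually_all.2 fun i => by
      have : Tendsto (fun h : ℝ => h ^ 2 * ∑ j, |R.a i j| * L) (𝓝 0)
          (𝓝 (0 ^ 2 * ∑ j, |R.a i j| * L)) := Continuous.tendsto (by fun_prop) 0
      simp only [zero_mul, ne_eq, OfNat.ofNat_ne_zero, not_false_eq_true, zero_pow] at this
      exact this.eventually_le_const (by norm_num)
  filter_upwards [e1, e2, e3] with h h1 h2 h3
  have h1' : ∀ j, |t₀ + R.c j * h - t₀| ≤ ε := fun j => by simpa using h1 j
  set S : Set (Fin s → EuclideanSpace ℝ (Fin d)) := {Q | ∀ i, ‖Q i - q₀‖ ≤ ε} with hS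
  set Ψ : (Fin s → EuclideanSpace ℝ (Fin d)) → Fin s → EuclideanSpace ℝ (Fin d) := fun Q i =>
    q₀ + (h * R.c i) • v₀ + h ^ 2 • ∑ j, R.a i j • f (t₀ + R.c j * h, Q j) with hΨ
  have hmaps : Set.MapsTo Ψ S S := by
    intro Q hQ i
    refine le_trans ?_ (h2 i)
    have : Ψ Q i - q₀ = (h * R.c i) • v₀ + h ^ 2 • ∑ j, R.a i j • f (t₀ + R.c j * h, Q j) := by
      simp only [hΨ]; abel
    rw [this]
    refine (norm_add_le _ _).trans ?_
    rw [norm_smul, norm_smul, Real.norm_eq_abs, Real.norm_of_nonneg (sq_nonneg h)]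
    gcongr
    refine (norm_sum_le _ _).trans (sum_le_sum fun j _ => ?_)
    rw [norm_smul, Real.norm_eq_abs]
    gcongr
    exact hbd _ _ (h1' j) (hQ j)
  have hcontr : LipschitzOnWith (1 / 2) Ψ S := by
    refine LipschitzOnWith.of_dist_le_mul fun Q hQ Q' hQ' => ?_
    refine (dist_pi_le_iff (by positivity)).2 fun i => ?_
    have : Ψ Q i - Ψ Q' i = h ^ 2 • ∑ j, R.a i j •
        (f (t₀ + R.c j * h, Q j) - f (t₀ + R.c j * h, Q' j)) := by
      simp only [hΨ, smul_sub, sum_sub_distrib]; abel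
    rw [dist_eq_norm, this, norm_smul, Real.norm_of_nonneg (sq_nonneg h)]
    have hsum : ‖∑ j, R.a i j • (f (t₀ + R.c j * h, Q j) - f (t₀ + R.c j * h, Q' j))‖ ≤
        (∑ j, |R.a i j| * L) * dist Q Q' := by
      rw [sum_mul]
      refine (norm_sum_le _ _).trans (sum_le_sum fun j _ => ?_)
      have hL : 0 ≤ L := (norm_nonneg _).trans (hbd _ _ (h1' j) (hQ j))
      rw [norm_smul, Real.norm_eq_abs, mul_assoc]
      gcongr
      refine (hlip _ _ _ (h1' j) (hQ j) (hQ' j)).trans ?_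
      gcongr
      rw [← dist_eq_norm]
      exact dist_le_pi_dist Q Q' j
    calc _ ≤ h ^ 2 * ((∑ j, |R.a i j| * L) * dist Q Q') := by gcongr
      _ = (h ^ 2 * ∑ j, |R.a i j| * L) * dist Q Q' := by ring
      _ ≤ 1 / 2 * dist Q Q' := by gcongr; exact h3 i
      _ = _ := by simp
  have hclosed : IsClosed S := by
    rw [hS, Set.ofPred_forall]
    exact isClosed_iInter fun i => isClosed_le (by fun_prop) continuous_const
  have hfix : ∀ Q, R.IsStage f t₀ q₀ v₀ h Q ↔ Function.IsFixedPt Ψ Q := fun Q => by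
    simp only [RKN.IsStage, Function.IsFixedPt, funext_iff, hΨ, eq_comm]
  have hcw : ContractingWith (1 / 2) (hmaps.restrict Ψ S S) :=
    ⟨by norm_num, hcontr.mapsToRestrict hmaps⟩
  have hmem : (fun _ => q₀) ∈ S := fun i => by simpa using hε.le
  obtain ⟨Q, hQS, hQ, -⟩ := hcw.exists_fixedPoint' hclosed.isComplete hmaps hmem (edist_ne_top _ _)
  refine ⟨Q, ⟨(hfix Q).2 hQ, hQS⟩, fun Q' hQ' => ?_⟩
  have hd := hcontr.dist_le_mul Q' hQ'.2 Q hQS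
  rw [(hfix Q').1 hQ'.1, hQ.eq] at hd
  have hnn := dist_nonneg (x := Q') (y := Q)
  norm_num at hd
  exact dist_le_zero.1 (by linarith)

namespace RKN

variable {s : ℕ}

/-- The quadrature conditions `∑ bᵢ cᵢᵏ = 1/(k+1)` for `k < ξ`. -/
def QuadCond (R : RKN s) (ξ : ℕ) : Prop :=
  ∀ k : ℕ, k + 1 ≤ ξ → ∑ i, R.b i * R.c i ^ k = ((k : ℝ) + 1)⁻¹

/-- The stage conditions `∑ⱼ aᵢⱼ cⱼᵏ = cᵢᵏ⁺² / ((k+1)(k+2))` for `k + 2 ≤ η`. -/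
def StageCond (R : RKN s) (η : ℕ) : Prop :=
  ∀ k : ℕ, k + 2 ≤ η → ∀ i,
    ∑ j, R.a i j * R.c j ^ k = (((k : ℝ) + 1) * ((k : ℝ) + 2))⁻¹ * R.c i ^ (k + 2)

/-- The adjoint conditions on `∑ᵢ bᵢ cᵢᵏ aᵢⱼ` for `k + 2 ≤ ζ`. -/
def AdjointCond (R : RKN s) (ζ : ℕ) : Prop :=
  ∀ k : ℕ, k + 2 ≤ ζ → ∀ j,
    ∑ i, R.b i * R.c i ^ k * R.a i j =
      R.b j * ((((k : ℝ) + 1) * ((k : ℝ) + 2))⁻¹ * R.c j ^ (k + 2) - ((k : ℝ) + 1)⁻¹ * R.c j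
        + ((k : ℝ) + 2)⁻¹)

variable {V : Type*} [NormedAddCommGroup V] [NormedSpace ℝ V]

/-- If `E = δ + h² a F` with `‖F‖ ≤ L ‖E‖`, then `E` is as small as `δ`. -/
theorem isBigO_error_of_defect (R : RKN s) {E F δ : ℝ → Fin s → V} {L : ℝ} {n : ℕ} (hL : 0 ≤ L)
    (hE : ∀ᶠ h in 𝓝 (0 : ℝ), ∀ i, E h i = δ h i + h ^ 2 • ∑ j, R.a i j • F h j)
    (hF : ∀ᶠ h in 𝓝 (0 : ℝ), ∀ j, ‖F h j‖ ≤ L * ‖E h j‖)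
    (hδ : ∀ i, (fun h => δ h i) =O[𝓝 0] fun h : ℝ => h ^ n) (i : Fin s) :
    (fun h => E h i) =O[𝓝 0] fun h : ℝ => h ^ n := by
  set A : ℝ := ∑ i, ∑ j, |R.a i j| with hA
  have hsmall : ∀ᶠ h in 𝓝 (0 : ℝ), h ^ 2 * (A * L) ≤ 1 / 2 := by
    have : Tendsto (fun h : ℝ => h ^ 2 * (A * L)) (𝓝 0) (𝓝 (0 ^ 2 * (A * L))) :=
      Continuous.tendsto (by fun_prop) 0
    rw [zero_pow two_ne_zero, zero_mul] at this
    exact this.eventually_le_const (by norm_num)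
  have hmain : E =O[𝓝 0] δ := by
    refine IsBigO.of_bound 2 ?_
    filter_upwards [hE, hF, hsmall] with h h1 h2 h3
    have hle : ‖E h‖ ≤ ‖δ h‖ + 1 / 2 * ‖E h‖ := by
      refine (pi_norm_le_iff_of_nonneg (by positivity)).2 fun i => ?_
      rw [h1 i]
      refine (norm_add_le _ _).trans (add_le_add (norm_le_pi_norm _ i) ?_)
      rw [norm_smul, Real.norm_of_nonneg (sq_nonneg h)]
      have hsum : ‖∑ j, R.a i j • F h j‖ ≤ A * L * ‖E h‖ := by
        calc _ ≤ ∑ j, |R.a i j| * (L * ‖E h‖) := by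
              refine (norm_sum_le _ _).trans (sum_le_sum fun j _ => ?_)
              rw [norm_smul, Real.norm_eq_abs]
              gcongr
              exact (h2 j).trans (by gcongr; exact norm_le_pi_norm _ j)
          _ = (∑ j, |R.a i j|) * (L * ‖E h‖) := by rw [sum_mul]
          _ ≤ A * (L * ‖E h‖) := by
              gcongr
              exact single_le_sum (f := fun i => ∑ j, |R.a i j|)
                (fun i _ => sum_nonneg fun j _ => abs_nonneg _) (mem_univ i)
          _ = _ := by ring
      calc _ ≤ h ^ 2 * (A * L * ‖E h‖) := by gcongr
        _ = h ^ 2 * (A * L) * ‖E h‖ := by ring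
        _ ≤ _ := by gcongr
    linarith
  exact isBigO_pi.1 (hmain.trans (isBigO_pi.2 hδ)) i

/-- The moments `∑ bᵢ cᵢᵏ Fᵢ` inherit the smallness of the moments of `E` when `F` depends on `E`
through operators with an expansion along the nodes. -/
theorem isBigO_moment_of_linearization (R : RKN s) {E F : ℝ → Fin s → V} {J : ℕ → V →L[ℝ] V}
    {r n : ℕ}
    (hF : ∀ i, (fun h => F h i - ∑ m ∈ range r, (R.c i * h) ^ m • J m (E h i))
      =O[𝓝 0] fun h : ℝ => h ^ r)
    (hM : ∀ k, (fun h => ∑ i, (R.b i * R.c i ^ k) • E h i)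
      =O[𝓝 0] fun h : ℝ => h ^ (min (r - k) n)) (k : ℕ) :
    (fun h => ∑ i, (R.b i * R.c i ^ k) • F h i) =O[𝓝 0] fun h : ℝ => h ^ (min (r - k) n) := by
  have h1 : (fun h => ∑ i, (R.b i * R.c i ^ k) •
      (F h i - ∑ m ∈ range r, (R.c i * h) ^ m • J m (E h i)))
      =O[𝓝 0] fun h : ℝ => h ^ (min (r - k) n) :=
    IsBigO.fun_sum fun i _ => ((hF i).const_smul_left _).pow_weaken (by omega)
  have h2 : (fun h => ∑ m ∈ range r, h ^ m • J m (∑ i, (R.b i * R.c i ^ (k + m)) • E h i))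
      =O[𝓝 0] fun h : ℝ => h ^ (min (r - k) n) :=
    IsBigO.fun_sum fun m _ =>
      ((((J m).isBigO_comp _ _).trans (hM (k + m))).pow_smul m).pow_weaken (by omega)
  refine (h1.add h2).congr_left fun h => ?_
  simp only [smul_sub, sum_sub_distrib, map_sum, map_smul, smul_sum, smul_smul]
  rw [sum_comm, sub_add_eq_add_sub, add_sub_assoc, ← sum_sub_distrib]
  convert add_zero _
  refine sum_eq_zero fun m _ => ?_
  rw [← sum_sub_distrib]
  refine sum_eq_zero fun i _ => ?_
  rw [sub_eq_zero]
  congr 1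
  ring

theorem AdjointCond.sum_smul {R : RKN s} {ζ : ℕ} (hR : R.AdjointCond ζ) {k : ℕ} (hk : k + 2 ≤ ζ)
    (F : Fin s → V) :
    ∑ i, (R.b i * R.c i ^ k) • ∑ j, R.a i j • F j =
      (((k : ℝ) + 1) * ((k : ℝ) + 2))⁻¹ • ∑ j, (R.b j * R.c j ^ (k + 2)) • F j
        - ((k : ℝ) + 1)⁻¹ • ∑ j, (R.b j * R.c j ^ 1) • F j
        + ((k : ℝ) + 2)⁻¹ • ∑ j, (R.b j * R.c j ^ 0) • F j := by
  simp only [smul_sum, smul_smul, ← sum_sub_distrib, ← sum_add_distrib, ← sub_smul, ← add_smul]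
  rw [sum_comm]
  refine sum_congr rfl fun j _ => ?_
  rw [← Finset.sum_smul, hR k hk j]
  congr 1
  ring

/-- The moments of the perturbation `F` caused by the stage errors. -/
theorem isBigO_moment (R : RKN s) {α β r : ℕ} (hDN : R.AdjointCond β) (hr : r ≤ α + β)
    {E F δ : ℝ → Fin s → V} {J : ℕ → V →L[ℝ] V}
    (hEq : ∀ᶠ h in 𝓝 (0 : ℝ), ∀ i, E h i = δ h i + h ^ 2 • ∑ j, R.a i j • F h j)
    (hE : ∀ i, (fun h => E h i) =O[𝓝 0] fun h : ℝ => h ^ (α + 1))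
    (hF : ∀ i, (fun h => F h i - ∑ m ∈ range r, (R.c i * h) ^ m • J m (E h i))
      =O[𝓝 0] fun h : ℝ => h ^ r)
    (hδ : ∀ k, k + 2 ≤ β → (fun h => ∑ i, (R.b i * R.c i ^ k) • δ h i)
      =O[𝓝 0] fun h : ℝ => h ^ (r - k)) (k : ℕ) :
    (fun h => ∑ i, (R.b i * R.c i ^ k) • F h i) =O[𝓝 0] fun h : ℝ => h ^ (r - k) := by
  have hE' : ∀ k, (fun h => ∑ i, (R.b i * R.c i ^ k) • E h i)
      =O[𝓝 0] fun h : ℝ => h ^ (α + 1) := fun k =>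
    IsBigO.fun_sum fun i _ => (hE i).const_smul_left _
  have key : ∀ n k, (fun h => ∑ i, (R.b i * R.c i ^ k) • E h i)
      =O[𝓝 0] fun h : ℝ => h ^ (min (r - k) n) := by
    intro n
    induction n with
    | zero => exact fun k => (hE' k).pow_weaken (by omega)
    | succ n ih =>
      intro k
      by_cases hk : k + 2 ≤ β
      · have hFm := isBigO_moment_of_linearization R hF ih
        have h1 : (fun h : ℝ => h ^ 2 • ∑ i, (R.b i * R.c i ^ k) • ∑ j, R.a i j • F h j)
            =O[𝓝 0] fun h : ℝ => h ^ (min (r - k) (n + 1)) := by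
          simp only [hDN.sum_smul hk]
          have h2 := (hFm (k + 2)).const_smul_left (((k : ℝ) + 1) * ((k : ℝ) + 2))⁻¹
          have h3 := ((hFm 1).const_smul_left ((k : ℝ) + 1)⁻¹).pow_weaken
            (show min (r - (k + 2)) n ≤ min (r - 1) n by omega)
          have h4 := ((hFm 0).const_smul_left ((k : ℝ) + 2)⁻¹).pow_weaken
            (show min (r - (k + 2)) n ≤ min (r - 0) n by omega)
          exact (((h2.sub h3).add h4).pow_smul 2).pow_weaken (by omega)
        refine (((hδ k hk).pow_weaken (min_le_left _ (n + 1))).add h1).congr' ?_ EventuallyEq.rfl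
        filter_upwards [hEq] with h hh
        simp only [hh, smul_add, sum_add_distrib]
        congr 1
        rw [smul_sum]
        exact sum_congr rfl fun i _ => smul_comm _ _ _
      · exact (hE' k).pow_weaken (by omega)
  refine (isBigO_moment_of_linearization R hF (key r) k).pow_weaken (by omega)

/-- Weighted sums of the stage defects. -/
theorem isBigO_defect (R : RKN s) {g u : ℝ → V} {a : ℕ → V} {N : ℕ}
    (hg : (fun x : ℝ => g x - ∑ m ∈ range N, x ^ m • a m) =O[𝓝 0] fun x : ℝ => x ^ N)
    (hu : (fun x : ℝ => u x - ∑ m ∈ range N, x ^ (m + 2) •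
      ((((m : ℝ) + 1) * ((m : ℝ) + 2))⁻¹ • a m)) =O[𝓝 0] fun x : ℝ => x ^ (N + 2))
    (w : Fin s → ℝ) {n : ℕ} (hn : n ≤ N + 2)
    (hw : ∀ m, m + 2 < n → ∑ i, w i * (∑ j, R.a i j * R.c j ^ m) =
      (((m : ℝ) + 1) * ((m : ℝ) + 2))⁻¹ * ∑ i, w i * R.c i ^ (m + 2)) :
    (fun h => ∑ i, w i • (h ^ 2 • ∑ j, R.a i j • g (R.c j * h) - u (R.c i * h)))
      =O[𝓝 0] fun h : ℝ => h ^ n := by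
  refine isBigO_pow_of_expansion (a := a) (N := N) (l := 2)
    (γ := fun m => ∑ i, w i * (∑ j, R.a i j * R.c j ^ m) -
      (((m : ℝ) + 1) * ((m : ℝ) + 2))⁻¹ * ∑ i, w i * R.c i ^ (m + 2)) ?_ hn
    (fun m hm => sub_eq_zero.2 (hw m hm))
  have h1 : (fun h : ℝ => h ^ 2 • ∑ i, w i • (∑ j, R.a i j • g (R.c j * h) -
      ∑ m ∈ range N, h ^ m • ((∑ j, R.a i j * R.c j ^ m) • a m)))
      =O[𝓝 0] fun h : ℝ => h ^ (2 + N) :=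
    (IsBigO.fun_sum fun i _ =>
      (isBigO_sum_smul_comp_mul hg (R.a i) R.c).const_smul_left (w i)).pow_smul 2
  have h2 : (fun h : ℝ => ∑ i, w i • (u (R.c i * h) - ∑ m ∈ range N, (R.c i * h) ^ (m + 2) •
      ((((m : ℝ) + 1) * ((m : ℝ) + 2))⁻¹ • a m))) =O[𝓝 0] fun h : ℝ => h ^ (N + 2) :=
    IsBigO.fun_sum fun i _ => (hu.comp_mul_left_pow (R.c i)).const_smul_left (w i)
  rw [add_comm] at h1
  refine (h1.sub h2).congr_left fun h => ?_
  have e1 : ∑ i, w i • ∑ m ∈ range N, h ^ m • ((∑ j, R.a i j * R.c j ^ m) • a m) =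
      ∑ m ∈ range N, h ^ m • ((∑ i, w i * ∑ j, R.a i j * R.c j ^ m) • a m) := by
    simp only [smul_sum, sum_smul (f := fun i => w i * _)]
    rw [sum_comm]
    refine sum_congr rfl fun m _ => sum_congr rfl fun i _ => ?_
    simp only [smul_smul]
    congr 1
    ring
  have e2 : ∑ i, w i • ∑ m ∈ range N, (R.c i * h) ^ (m + 2) •
      ((((m : ℝ) + 1) * ((m : ℝ) + 2))⁻¹ • a m) =
      ∑ m ∈ range N, h ^ (m + 2) •
        (((((m : ℝ) + 1) * ((m : ℝ) + 2))⁻¹ * ∑ i, w i * R.c i ^ (m + 2)) • a m) := by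
    simp only [smul_sum, smul_smul, mul_sum, sum_smul]
    rw [sum_comm]
    refine sum_congr rfl fun m _ => sum_congr rfl fun i _ => ?_
    congr 1
    ring
  have e3 : ∑ m ∈ range N, h ^ (m + 2) • ((∑ i, w i * (∑ j, R.a i j * R.c j ^ m) -
      (((m : ℝ) + 1) * ((m : ℝ) + 2))⁻¹ * ∑ i, w i * R.c i ^ (m + 2)) • a m) =
      h ^ 2 • ∑ m ∈ range N, h ^ m • ((∑ i, w i * ∑ j, R.a i j * R.c j ^ m) • a m) -
      ∑ m ∈ range N, h ^ (m + 2) •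
        (((((m : ℝ) + 1) * ((m : ℝ) + 2))⁻¹ * ∑ i, w i * R.c i ^ (m + 2)) • a m) := by
    rw [smul_sum, ← sum_sub_distrib]
    refine sum_congr rfl fun m _ => ?_
    rw [smul_smul (h ^ 2), ← pow_add, add_comm 2 m, ← smul_sub, ← sub_smul]
  rw [e3, ← e1, ← e2]
  simp only [smul_sub, sum_sub_distrib, smul_sum (r := h ^ 2) (s := univ) (f := fun i => w i • _),
    smul_comm (h ^ 2) (w _)]
  abel

/-- The defects of the quadrature for the numerical step. -/
theorem isBigO_quadrature_defect {c w : Fin s → ℝ} {g u : ℝ → V} {a : ℕ → V} {β : ℕ → ℝ} {N l : ℕ}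
    (hg : (fun x : ℝ => g x - ∑ m ∈ range N, x ^ m • a m) =O[𝓝 0] fun x : ℝ => x ^ N)
    (hu : (fun x : ℝ => u x - ∑ m ∈ range N, x ^ (m + l) • (β m • a m))
      =O[𝓝 0] fun x : ℝ => x ^ (N + l)) {n : ℕ} (hn : n ≤ N + l)
    (hw : ∀ m, m + l < n → ∑ i, w i * c i ^ m = β m) :
    (fun h => u h - h ^ l • ∑ i, w i • g (c i * h)) =O[𝓝 0] fun h : ℝ => h ^ n := by
  refine isBigO_pow_of_expansion (a := a) (N := N) (l := l)
    (γ := fun m => β m - ∑ i, w i * c i ^ m) ?_ hn (fun m hm => sub_eq_zero.2 (hw m hm).symm)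
  have h1 := (isBigO_sum_smul_comp_mul hg w c).pow_smul l
  rw [add_comm] at h1
  refine (hu.sub h1).congr_left fun h => ?_
  simp only [sub_smul, smul_sub, sum_sub_distrib, smul_sum (r := h ^ l) (s := range N), smul_smul,
    ← mul_assoc, ← pow_add, add_comm l]
  abel

end RKN

section Solution

variable {d : ℕ} {f : ℝ × EuclideanSpace ℝ (Fin d) → EuclideanSpace ℝ (Fin d)} {t₀ : ℝ}
  {q₀ v₀ : EuclideanSpace ℝ (Fin d)} {q v : ℝ → EuclideanSpace ℝ (Fin d)}

theorem IsLocalSolution.contDiffAt_graph (hf : ContDiff ℝ ∞ f)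
    (hq : IsLocalSolution f t₀ q₀ v₀ q v) (n : ℕ) :
    ContDiffAt ℝ n (fun x : ℝ => (t₀ + x, q (t₀ + x))) 0 := by
  have ht : ContDiffAt ℝ n (fun x : ℝ => t₀ + x) 0 := contDiffAt_const.add contDiffAt_id
  refine ht.prodMk (ContDiffAt.comp (0 : ℝ) (g := q) ?_ ht)
  simpa using (hq.contDiffAt hf n).1

/-- Taylor expansions of the exact solution in terms of that of its second derivative. -/
theorem IsLocalSolution.exists_expansions (hf : ContDiff ℝ ∞ f)
    (hq : IsLocalSolution f t₀ q₀ v₀ q v) (N : ℕ) :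
    ∃ a : ℕ → EuclideanSpace ℝ (Fin d),
      (fun x : ℝ => f (t₀ + x, q (t₀ + x)) - ∑ m ∈ range N, x ^ m • a m)
        =O[𝓝 0] (fun x : ℝ => x ^ N) ∧
      (fun x : ℝ => (v (t₀ + x) - v₀) - ∑ m ∈ range N, x ^ (m + 1) • (((m : ℝ) + 1)⁻¹ • a m))
        =O[𝓝 0] (fun x : ℝ => x ^ (N + 1)) ∧
      (fun x : ℝ => (q (t₀ + x) - q₀ - x • v₀) - ∑ m ∈ range N, x ^ (m + 2) •
        ((((m : ℝ) + 1) * ((m : ℝ) + 2))⁻¹ • a m)) =O[𝓝 0] fun x : ℝ => x ^ (N + 2) := by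
  obtain ⟨a, ha⟩ := exists_taylor_expansion N
    ((contDiff_infty.1 hf N).contDiffAt.comp (0 : ℝ) (hq.contDiffAt_graph hf N))
  have ht : Tendsto (fun x : ℝ => t₀ + x) (𝓝 0) (𝓝 t₀) := by
    simpa using (continuous_const_add t₀).tendsto (0 : ℝ)
  have hv : ∀ᶠ x in 𝓝 (0 : ℝ), HasDerivAt (fun x => v (t₀ + x) - v₀)
      (f (t₀ + x, q (t₀ + x))) x := by
    filter_upwards [ht.eventually hq.hasDeriv_vel] with x hx
    exact (hx.comp_const_add t₀ x).sub_const _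
  have hq' : ∀ᶠ x in 𝓝 (0 : ℝ), HasDerivAt (fun x => q (t₀ + x) - q₀ - x • v₀)
      (v (t₀ + x) - v₀) x := by
    filter_upwards [ht.eventually hq.hasDeriv_pos] with x hx
    have h := ((hx.comp_const_add t₀ x).sub_const q₀).sub ((hasDerivAt_id x).smul_const v₀)
    rw [one_smul] at h
    exact h
  have h1 := isBigO_expansion_of_hasDerivAt (l := 0) hv (by simp [hq.init_vel]) ha
  simp only [Nat.cast_zero, add_zero] at h1
  have h2 := isBigO_expansion_of_hasDerivAt (l := 1) hq' (by simp [hq.init_pos]) h1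
  refine ⟨a, ha, h1, ?_⟩
  refine h2.congr_left fun x => ?_
  congr 1
  refine sum_congr rfl fun m _ => ?_
  rw [smul_smul (_ : ℝ) (_ : ℝ) (a m), ← mul_inv_rev, Nat.cast_one, add_assoc (m : ℝ) 1 1,
    one_add_one_eq_two]

end Solution

namespace RKN

theorem QuadCond.defect_moment {s : ℕ} {R : RKN s} {r β : ℕ} (hB : R.QuadCond r)
    (hDN : R.AdjointCond β) {k m : ℕ} (hk : k + 2 ≤ β) (hm : m + 2 < r - k) :
    ∑ i, (R.b i * R.c i ^ k) * (∑ j, R.a i j * R.c j ^ m) =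
      (((m : ℝ) + 1) * ((m : ℝ) + 2))⁻¹ * ∑ i, (R.b i * R.c i ^ k) * R.c i ^ (m + 2) := by
  have h1 := hDN.sum_smul hk (fun j => R.c j ^ m)
  simp only [smul_eq_mul, mul_assoc, ← pow_add] at h1 ⊢
  rw [h1, hB _ (by omega), hB _ (by omega), hB _ (by omega), hB _ (by omega)]
  push_cast
  field_simp
  ring

/-- The order of a Runge-Kutta-Nystrom method satisfying the simplifying conditions. -/
theorem hasOrderAtLeast_of_conditions {s : ℕ} (R : RKN s) {α β r : ℕ} (hB : R.QuadCond r)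
    (hCN : R.StageCond α) (hDN : R.AdjointCond β) (hbbar : ∀ i, R.bbar i = R.b i * (1 - R.c i))
    (hα : r ≤ 2 * α + 2) (hαβ : r ≤ α + β) : R.HasOrderAtLeast r := by
  intro d f hf t₀ q₀ v₀ q v hq
  obtain ⟨ε, hε, L, hL, hest⟩ := exists_local_estimates hf t₀ q₀
  have hex := R.eventually_existsUnique_isStage v₀ hε (fun t x ht hx => (hest t x ht hx).1)
    (fun t x y ht hx hy => ((hest t x ht hx).2 y hy).1)
  obtain ⟨Q, hQ⟩ := (hex.mono fun h hh => hh.exists).choice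
  obtain ⟨a, hg, hv, hu⟩ := hq.exists_expansions hf (r + α)
  obtain ⟨J, hJ⟩ := exists_taylor_expansion (V := EuclideanSpace ℝ (Fin d) →L[ℝ]
      EuclideanSpace ℝ (Fin d)) r (g := fun x =>
      (fderiv ℝ f (t₀ + x, q (t₀ + x))).comp (ContinuousLinearMap.inr ℝ ℝ _))
    ((((hf.fderiv_right (m := ∞) (by simp)).of_le
      (by exact_mod_cast le_top)).contDiffAt.comp (0 : ℝ)
      (hq.contDiffAt_graph hf r)).clm_comp contDiffAt_const)
  set E : ℝ → Fin s → EuclideanSpace ℝ (Fin d) := fun h i => Q h i - q (t₀ + R.c i * h) with hE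
  set F : ℝ → Fin s → EuclideanSpace ℝ (Fin d) := fun h i =>
    f (t₀ + R.c i * h, Q h i) - f (t₀ + R.c i * h, q (t₀ + R.c i * h)) with hF
  set u : ℝ → EuclideanSpace ℝ (Fin d) := fun x => q (t₀ + x) - q₀ - x • v₀ with hu_def
  set g : ℝ → EuclideanSpace ℝ (Fin d) := fun x => f (t₀ + x, q (t₀ + x)) with hg_def
  set δ : ℝ → Fin s → EuclideanSpace ℝ (Fin d) := fun h i =>
    h ^ 2 • ∑ j, R.a i j • g (R.c j * h) - u (R.c i * h) with hδ
  have hEq : ∀ᶠ h in 𝓝 (0 : ℝ), ∀ i, E h i = δ h i + h ^ 2 • ∑ j, R.a i j • F h j := by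
    filter_upwards [hQ] with h hh i
    simp only [hE, hδ, hF, hg_def, hu_def]
    rw [hh.1 i]
    simp only [smul_sub, sum_sub_distrib, mul_comm (R.c i) h]
    abel
  have hnear : ∀ᶠ h in 𝓝 (0 : ℝ), ∀ i, |t₀ + R.c i * h - t₀| ≤ ε ∧
      ‖q (t₀ + R.c i * h) - q₀‖ ≤ ε := by
    refine eventually_all.2 fun i => ?_
    have ht : Tendsto (fun h : ℝ => t₀ + R.c i * h) (𝓝 0) (𝓝 t₀) := by
      have : Tendsto (fun h : ℝ => t₀ + R.c i * h) (𝓝 0) (𝓝 (t₀ + R.c i * 0)) :=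
        Continuous.tendsto (by fun_prop) 0
      simpa using this
    have hqt := (hq.hasDeriv_pos.self_of_nhds.continuousAt.tendsto).comp ht
    rw [hq.init_pos] at hqt
    filter_upwards [ht.eventually (Metric.closedBall_mem_nhds t₀ hε),
      hqt.eventually (Metric.closedBall_mem_nhds q₀ hε)] with h h1 h2
    exact ⟨by simpa [Real.dist_eq] using h1, by simpa [dist_eq_norm] using h2⟩
  have hEbig : ∀ i, (fun h => E h i) =O[𝓝 0] fun h : ℝ => h ^ (α + 1) := by
    refine isBigO_error_of_defect R hL hEq ?_ fun i => ?_
    · filter_upwards [hQ, hnear] with h h1 h2 j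
      exact ((hest _ _ (h2 j).1 (h1.2 j)).2 _ (h2 j).2).1
    · have := isBigO_defect R hg hu (Pi.single i 1) (n := α + 1) (by omega) fun m hm => by
        simp [Pi.single_apply, hCN m (by omega)]
      simpa [Pi.single_apply, hδ] using this
  have hFlin : ∀ i, (fun h => F h i - ∑ m ∈ range r, (R.c i * h) ^ m • J m (E h i))
      =O[𝓝 0] fun h : ℝ => h ^ r := by
    intro i
    have h1 : (fun h => F h i - fderiv ℝ f (t₀ + R.c i * h, q (t₀ + R.c i * h)) (0, E h i))
        =O[𝓝 0] fun h : ℝ => h ^ r := by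
      have hsq : (fun h => ‖E h i‖ ^ 2) =O[𝓝 0] fun h : ℝ => h ^ r := by
        refine IsBigO.pow_weaken (m := (α + 1) * 2) ?_ (by omega)
        simpa [← pow_mul] using (hEbig i).norm_left.pow 2
      refine IsBigO.trans (IsBigO.of_bound L ?_) hsq
      filter_upwards [hQ, hnear] with h h1 h2
      rw [Real.norm_of_nonneg (sq_nonneg ‖E h i‖)]
      exact ((hest _ _ (h2 i).1 (h1.2 i)).2 _ (h2 i).2).2
    have h2 := (hJ.comp_mul_left_pow (R.c i)).norm_left.mul
      ((hEbig i).pow_weaken (Nat.zero_le _)).norm_left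
    have h3 : (fun h => fderiv ℝ f (t₀ + R.c i * h, q (t₀ + R.c i * h)) (0, E h i) -
        ∑ m ∈ range r, (R.c i * h) ^ m • J m (E h i)) =O[𝓝 0] fun h : ℝ => h ^ r := by
      refine IsBigO.trans (IsBigO.of_bound 1 (Eventually.of_forall fun h => ?_))
        (by simpa using h2)
      rw [one_mul, norm_mul, norm_norm, norm_norm]
      refine le_trans (le_of_eq ?_) (ContinuousLinearMap.le_opNorm _ (E h i))
      simp
    simpa using h1.add h3
  have hmom := isBigO_moment R hDN hαβ hEq hEbig hFlin fun k hk =>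
    isBigO_defect R hg hu (fun i => R.b i * R.c i ^ k) (n := r - k) (by omega)
      fun m hm => hB.defect_moment hDN hk hm
  have hvel : (fun h => v (t₀ + h) - R.stepVel f t₀ v₀ h (Q h))
      =O[𝓝 0] fun h : ℝ => h ^ (r + 1) := by
    have h1 := isBigO_quadrature_defect (c := R.c) (w := R.b) hg hv (n := r + 1) (by omega)
      fun m hm => hB m (by omega)
    have h2 := ((hmom 0).pow_smul 1).pow_weaken (show r + 1 ≤ 1 + (r - 0) by omega)
    refine (h1.sub h2).congr_left fun h => ?_
    simp only [RKN.stepVel, hF, pow_zero, mul_one, pow_one, smul_sub, sum_sub_distrib]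
    abel
  have hpos : (fun h => q (t₀ + h) - R.stepPos f t₀ q₀ v₀ h (Q h))
      =O[𝓝 0] fun h : ℝ => h ^ (r + 1) := by
    have h1 := isBigO_quadrature_defect (c := R.c) (w := R.bbar) hg hu (n := r + 1) (by omega)
      fun m hm => by
        have e1 := hB m (by omega)
        have e2 := hB (m + 1) (by omega)
        have e3 : ∀ i, R.bbar i * R.c i ^ m = R.b i * R.c i ^ m - R.b i * R.c i ^ (m + 1) :=
          fun i => by rw [hbbar]; ring
        simp only [e3, sum_sub_distrib, e1, e2]
        push_cast
        field_simp
        ring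
    have h2 := (((hmom 0).pow_weaken (show r - 1 ≤ r - 0 by omega)).sub (hmom 1)).pow_smul 2
    have h3 := h2.pow_weaken (show r + 1 ≤ 2 + (r - 1) by omega)
    refine (h1.sub h3).congr_left fun h => ?_
    have e : ∑ i, (R.b i * R.c i ^ 0) • F h i - ∑ i, (R.b i * R.c i ^ 1) • F h i =
        ∑ i, R.bbar i • F h i := by
      rw [← sum_sub_distrib]
      refine sum_congr rfl fun i _ => ?_
      rw [← sub_smul, hbbar]
      congr 1
      ring
    rw [e]
    simp only [RKN.stepPos, hF, smul_sub, sum_sub_distrib]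
    abel
  obtain ⟨K₁, hK₁⟩ := hpos.bound
  obtain ⟨K₂, hK₂⟩ := hvel.bound
  obtain ⟨η, hη, hball⟩ := Metric.eventually_nhds_iff_ball.1
    (hex.and (hQ.and (hK₁.and hK₂)))
  refine ⟨ε, hε, η / 2, by positivity, max K₁ K₂, fun h hh => ?_⟩
  obtain ⟨hun, hst, hk1, hk2⟩ := hball h (by
    rw [Metric.mem_ball, dist_zero_right, Real.norm_eq_abs]; linarith)
  refine ⟨hun, fun Q' hQ' hQ'ε => ?_⟩
  rw [hun.unique ⟨hQ', hQ'ε⟩ hst]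
  rw [norm_pow, Real.norm_eq_abs] at hk1 hk2
  exact ⟨hk1.trans (by gcongr; exact le_max_left _ _), hk2.trans (by gcongr; exact le_max_right _ _)⟩

end RKN

/-- Exactness of the quadrature formula, with a degree bound and a function that is polynomial only
on `I`. -/
theorem QuadOrder.sum_eq {s : ℕ} {I : Set ℝ} (hI : MeasurableSet I) {w : ℝ → ℝ} {c : Fin s → ℝ}
    {p : ℕ} (hp : QuadOrder I w c p) {u : ℝ → ℝ} {Φ : Polynomial ℝ} (hΦ : Φ.natDegree + 1 ≤ p)
    (hu : ∀ x ∈ I, u x = Φ.eval x * w x) :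
    ∑ i, quadWeight I w c i * Φ.eval (c i) = ∫ x in I, u x := by
  rw [setIntegral_congr_fun hI hu, hp Φ]
  exact Polynomial.degree_le_natDegree.trans_lt (by exact_mod_cast hΦ)

/-- Partial evaluation of a polynomial in two variables at the second variable. -/
theorem exists_polynomial_eval_fst (P : MvPolynomial (Fin 2) ℝ) (y : ℝ) :
    ∃ Φ : Polynomial ℝ, Φ.natDegree ≤ MvPolynomial.degreeOf 0 P ∧
      ∀ x, Φ.eval x = MvPolynomial.eval ![x, y] P := by
  refine ⟨MvPolynomial.aeval ![Polynomial.X, Polynomial.C y] P, ?_, fun x => ?_⟩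
  · rw [MvPolynomial.aeval_def, MvPolynomial.eval₂_eq']
    refine Polynomial.natDegree_sum_le_of_forall_le _ _ fun e he => ?_
    rw [Fin.prod_univ_two]
    simp only [Matrix.cons_val_zero, Matrix.cons_val_one, ← Polynomial.C_pow,
      Polynomial.algebraMap_eq]
    refine (Polynomial.natDegree_C_mul_le _ _).trans ?_
    refine (Polynomial.natDegree_mul_C_le _ _).trans ?_
    rw [Polynomial.natDegree_X_pow]
    exact MvPolynomial.monomial_le_degreeOf 0 he
  · rw [← Polynomial.coe_evalRingHom, MvPolynomial.aeval_def, MvPolynomial.hom_eval₂,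
      MvPolynomial.eval, MvPolynomial.coe_eval₂Hom]
    congr 1
    · ext z; simp
    · ext i; fin_cases i <;> simp

/-- Partial evaluation of a polynomial in two variables at the first variable. -/
theorem exists_polynomial_eval_snd (P : MvPolynomial (Fin 2) ℝ) (x : ℝ) :
    ∃ Φ : Polynomial ℝ, Φ.natDegree ≤ MvPolynomial.degreeOf 1 P ∧
      ∀ y, Φ.eval y = MvPolynomial.eval ![x, y] P := by
  refine ⟨MvPolynomial.aeval ![Polynomial.C x, Polynomial.X] P, ?_, fun y => ?_⟩
  · rw [MvPolynomial.aeval_def, MvPolynomial.eval₂_eq']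
    refine Polynomial.natDegree_sum_le_of_forall_le _ _ fun e he => ?_
    rw [Fin.prod_univ_two]
    simp only [Matrix.cons_val_zero, Matrix.cons_val_one, ← Polynomial.C_pow,
      Polynomial.algebraMap_eq]
    refine (Polynomial.natDegree_C_mul_le _ _).trans ?_
    refine (Polynomial.natDegree_C_mul_le _ _).trans ?_
    rw [Polynomial.natDegree_X_pow]
    exact MvPolynomial.monomial_le_degreeOf 1 he
  · rw [← Polynomial.coe_evalRingHom, MvPolynomial.aeval_def, MvPolynomial.hom_eval₂,
      MvPolynomial.eval, MvPolynomial.coe_eval₂Hom]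
    congr 1
    · ext z; simp
    · ext i; fin_cases i <;> simp

namespace CSRKN

variable {s : ℕ} {M : CSRKN} {c : Fin s → ℝ} {p : ℕ}

theorem quadCond_discretize (hC : ∀ τ ∈ M.I, M.C τ = τ) (hcI : ∀ i, c i ∈ M.I)
    (hp : QuadOrder M.I M.w c p) {ξ : ℕ} (hB : M.SimplB ξ) {PB : Polynomial ℝ}
    (hPB : ∀ τ ∈ M.I, M.B τ = PB.eval τ) {r : ℕ} (hξ : r ≤ ξ) (hr : r = 0 ∨ r + PB.natDegree ≤ p) :
    (M.discretize c).QuadCond r := by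
  intro k hk
  have h := hp.sum_eq M.interval.measurableSet (Φ := PB * Polynomial.X ^ k)
    (u := fun τ => M.B τ * M.w τ * M.C τ ^ (k + 1 - 1)) ?_ ?_
  · rw [(hB (k + 1) (by omega) (by omega)).2] at h
    push_cast at h
    rw [← one_div, ← h]
    refine sum_congr rfl fun i _ => ?_
    simp only [discretize, hC _ (hcI i), hPB _ (hcI i), Polynomial.eval_mul, Polynomial.eval_pow,
      Polynomial.eval_X]
    ring
  · have := Polynomial.natDegree_mul_le (p := PB) (q := Polynomial.X ^ k)
    rw [Polynomial.natDegree_X_pow] at this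
    omega
  · intro τ hτ
    simp only [hC τ hτ, hPB τ hτ, Polynomial.eval_mul, Polynomial.eval_pow, Polynomial.eval_X,
      Nat.add_sub_cancel]
    ring

theorem stageCond_discretize (hC : ∀ τ ∈ M.I, M.C τ = τ) (hcI : ∀ i, c i ∈ M.I)
    (hp : QuadOrder M.I M.w c p) {η : ℕ} (hCN : M.SimplCN η) {PA : MvPolynomial (Fin 2) ℝ}
    (hPA : ∀ τ ∈ M.I, ∀ σ ∈ M.I, M.A τ σ = MvPolynomial.eval ![τ, σ] PA) {α : ℕ} (hη : α ≤ η)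
    (hα : α = 0 ∨ α + MvPolynomial.degreeOf 1 PA ≤ p + 1) :
    (M.discretize c).StageCond α := by
  intro k hk i
  obtain ⟨Φ, hdeg, hΦ⟩ := exists_polynomial_eval_snd PA (c i)
  have h := hp.sum_eq M.interval.measurableSet (Φ := Φ * Polynomial.X ^ k)
    (u := fun σ => M.A (c i) σ * M.w σ * M.C σ ^ (k + 1 - 1)) ?_ ?_
  · rw [(hCN (k + 1) (by omega) (by omega) _ (hcI i)).2, hC _ (hcI i)] at h
    push_cast at h
    have e : (((k : ℝ) + 1) * ((k : ℝ) + 2))⁻¹ * (M.discretize c).c i ^ (k + 2) =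
        c i ^ (k + 1 + 1) / (((k : ℝ) + 1) * ((k : ℝ) + 1 + 1)) := by
      simp only [discretize]
      rw [hC _ (hcI i), add_assoc (k : ℝ) 1 1, one_add_one_eq_two]
      ring
    rw [e, ← h]
    refine sum_congr rfl fun j _ => ?_
    simp only [discretize, hC _ (hcI j), hPA _ (hcI i) _ (hcI j), Polynomial.eval_mul,
      Polynomial.eval_pow, Polynomial.eval_X, hΦ]
    ring
  · have := Polynomial.natDegree_mul_le (p := Φ) (q := Polynomial.X ^ k)
    rw [Polynomial.natDegree_X_pow] at this
    omega
  · intro τ hτ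
    simp only [hC τ hτ, hPA _ (hcI i) τ hτ, Polynomial.eval_mul, Polynomial.eval_pow,
      Polynomial.eval_X, Nat.add_sub_cancel, hΦ]
    ring

theorem adjointCond_discretize (hC : ∀ τ ∈ M.I, M.C τ = τ) (hcI : ∀ i, c i ∈ M.I)
    (hp : QuadOrder M.I M.w c p) {ζ : ℕ} (hDN : M.SimplDN ζ) {PA : MvPolynomial (Fin 2) ℝ}
    (hPA : ∀ τ ∈ M.I, ∀ σ ∈ M.I, M.A τ σ = MvPolynomial.eval ![τ, σ] PA) {PB : Polynomial ℝ}
    (hPB : ∀ τ ∈ M.I, M.B τ = PB.eval τ) {β : ℕ} (hζ : β ≤ ζ)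
    (hβ : β = 0 ∨ β + MvPolynomial.degreeOf 0 PA + PB.natDegree ≤ p + 1) :
    (M.discretize c).AdjointCond β := by
  intro k hk j
  obtain ⟨Φ, hdeg, hΦ⟩ := exists_polynomial_eval_fst PA (c j)
  have h := hp.sum_eq M.interval.measurableSet (Φ := PB * Φ * Polynomial.X ^ k)
    (u := fun τ => M.B τ * M.w τ * M.C τ ^ (k + 1 - 1) * M.A τ (c j)) ?_ ?_
  · rw [(hDN (k + 1) (by omega) (by omega) _ (hcI j)).2, hC _ (hcI j)] at h
    push_cast at h
    have e : ∑ i, (M.discretize c).b i * (M.discretize c).c i ^ k * (M.discretize c).a i j =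
        quadWeight M.I M.w c j * ∑ i, quadWeight M.I M.w c i *
          (PB * Φ * Polynomial.X ^ k).eval (c i) := by
      rw [mul_sum]
      refine sum_congr rfl fun i _ => ?_
      simp only [discretize, hC _ (hcI i), hPA _ (hcI i) _ (hcI j), hPB _ (hcI i),
        Polynomial.eval_mul, Polynomial.eval_pow, Polynomial.eval_X, hΦ]
      ring
    rw [e, h]
    simp only [discretize, hC _ (hcI j), add_assoc (k : ℝ) 1 1, one_add_one_eq_two]
    ring
  · have h1 := Polynomial.natDegree_mul_le (p := PB * Φ) (q := Polynomial.X ^ k)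
    have h2 := Polynomial.natDegree_mul_le (p := PB) (q := Φ)
    rw [Polynomial.natDegree_X_pow] at h1
    omega
  · intro τ hτ
    simp only [hC τ hτ, hPA _ hτ _ (hcI j), hPB τ hτ, Polynomial.eval_mul, Polynomial.eval_pow,
      Polynomial.eval_X, Nat.add_sub_cancel, hΦ]
    ring

end CSRKN

theorem mainTheorem4 (M : CSRKN)
    (hC : ∀ τ ∈ M.I, M.C τ = τ)
    (hBbar : ∀ τ ∈ M.I, M.Bbar τ = M.B τ * (1 - τ))
    (ξ η ζ : ℕ) (hB : M.SimplB ξ) (hCN : M.SimplCN η) (hDN : M.SimplDN ζ)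
    (PA : MvPolynomial (Fin 2) ℝ)
    (hPA : ∀ τ ∈ M.I, ∀ σ ∈ M.I, M.A τ σ = MvPolynomial.eval ![τ, σ] PA)
    (PB : Polynomial ℝ) (hPB : ∀ τ ∈ M.I, M.B τ = PB.eval τ)
    (πAτ πAσ πBτ : ℕ)
    (hπAτ : MvPolynomial.degreeOf 0 PA ≤ πAτ) (hπAσ : MvPolynomial.degreeOf 1 PA ≤ πAσ)
    (hπBτ : PB.natDegree ≤ πBτ)
    (s : ℕ) (c : Fin s → ℝ) (hcI : ∀ i, c i ∈ M.I) (hc : Function.Injective c)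
    (p : ℕ) (hp : QuadOrder M.I M.w c p)
    (ρ α β : ℤ)
    (hρ : ρ = min (ξ : ℤ) ((p : ℤ) - πBτ))
    (hα : α = min (η : ℤ) ((p : ℤ) - πAσ + 1))
    (hβ : β = min (ζ : ℤ) ((p : ℤ) - πAτ - πBτ + 1)) :
    ∀ r : ℕ, (r : ℤ) ≤ min ρ (min (2 * α + 2) (α + β)) →
      (M.discretize c).HasOrderAtLeast r := by
  intro r hr
  refine RKN.hasOrderAtLeast_of_conditions (α := α.toNat) (β := β.toNat) _
    (CSRKN.quadCond_discretize hC hcI hp hB hPB ?_ ?_)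
    (CSRKN.stageCond_discretize hC hcI hp hCN hPA ?_ ?_)
    (CSRKN.adjointCond_discretize hC hcI hp hDN hPA hPB ?_ ?_)
    (fun i => ?_) ?_ ?_
  case refine_7 =>
    simp only [CSRKN.discretize, hBbar _ (hcI i), hC _ (hcI i)]
    ring
  all_goals omega
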